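/- Let $s\ge 2$ and let $K_{n_1,\dots,n_s}$ be the complete $s$-partite graph with parts $X_1,\dots,X_s$, where $|X_i|=n_i\ge 1$, and put $n=n_1+\cdots+n_s$. Let $F$ be a spanning forest of $K_{n_1,\dots,n_s}$ (an acyclic subgraph containing all vertices, where isolated vertices are allowed) with $c$ components $T_1,\dots,T_c$. For $1\le i\le s$ and $1\le p\le c$ put $$m_p=|V(T_p)|,\qquad n_{ip}=|X_i\cap V(T_p)|,\qquad \alpha_p=n\,m_p-\sum_{i=1}^s n_i n_{ip}.$$ Let $\tau_F(K_{n_1,\dots,n_s})$ be the number of spanning trees of $K_{n_1,\dots,n_s}$ that contain all edges of $F$. Then for any $i,j\in\{1,\dots,s\}$, $$\tau_F(K_{n_1,\dots,n_s})=\frac{C_{ij}}{n_i(n-n_j)}\prod_{p=1}^c\alpha_p,$$ where $C_{ij}$ is the cofactor corresponding to the $(i,j)$ entry (that is, $(-1)^{i+j}$ times the determinant of the matrix obtained by deleting row $i$ and column $j$) of the $s\times s$ matrix whose $(k,l)$ entry is $$\delta_{kl}-\sum_{p=1}^c\frac{n_{lp}(m_p-n_{kp})}{\alpha_p},$$ with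 $\delta_{kl}=1$ if $k=l$ and $\delta_{kl}=0$ otherwise. -/

import Mathlib

namespace SpanForest

variable {s c : ℕ} {X : Fin s → Type*}

/-- The complete `s`-partite graph with parts `X 0, …, X (s - 1)`. -/
abbrev K (X : Fin s → Type*) : SimpleGraph (Σ i, X i) :=
  SimpleGraph.completeMultipartiteGraph X

/-- `T` is a spanning tree of `G`, as a simple graph on the vertex set of `G`. -/
def IsSpanningTree {V : Type*} (G T : SimpleGraph V) : Prop :=
  T ≤ G ∧ T.IsTree

/-- `F` is a spanning forest of `G`: an acyclic subgraph with all the vertices of `G`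
(isolated vertices are allowed). -/
def IsSpanningForest {V : Type*} (G F : SimpleGraph V) : Prop :=
  F ≤ G ∧ F.IsAcyclic

/-- The number of spanning trees of `G` containing every edge of `F`. -/
noncomputable def tau {V : Type*} (G F : SimpleGraph V) : ℕ :=
  {T : SimpleGraph V | IsSpanningTree G T ∧ F ≤ T}.ncard

/-- The `i`-th part, as a set of vertices. -/
def part (X : Fin s → Type*) (i : Fin s) : Set (Σ i, X i) := {v | v.1 = i}

/-- `n_i`, the size of the `i`-th part. -/
noncomputable def partSize (X : Fin s → Type*) (i : Fin s) : ℕ := (part X i).ncard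

/-- `n = n_1 + ⋯ + n_s`. -/
noncomputable def order (X : Fin s → Type*) : ℕ := ∑ i, partSize X i

/-- `m_p`, the number of vertices of a component. -/
noncomputable def compSize {F : SimpleGraph (Σ i, X i)} (T : F.ConnectedComponent) : ℕ :=
  T.supp.ncard

/-- `n_{ip}`, the number of vertices of the `i`-th part in a component. -/
noncomputable def interSize {F : SimpleGraph (Σ i, X i)} (i : Fin s)
    (T : F.ConnectedComponent) : ℕ :=
  (part X i ∩ T.supp).ncard

/-- `α_p = n m_p - ∑ i, n_i n_{ip}`. -/
noncomputable def alpha {F : SimpleGraph (Σ i, X i)} (T : F.ConnectedComponent) : ℚ :=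
  (order X : ℚ) * compSize T - ∑ i, (partSize X i : ℚ) * interSize i T

/-- The `s × s` matrix `I - (∑ p, n_{jp} (m_p - n_{ip}) / α_p)_{ij}`, where the components
of `F` are listed as `T 0, …, T (c - 1)`. -/
noncomputable def Z {F : SimpleGraph (Σ i, X i)} (T : Fin c ≃ F.ConnectedComponent) :
    Matrix (Fin s) (Fin s) ℚ :=
  1 - Matrix.of fun i j =>
    ∑ p, (interSize j (T p) : ℚ) * ((compSize (T p) : ℚ) - interSize i (T p)) / alpha (T p)

/-- The cofactor of a square matrix corresponding to the `(i, j)` entry: the signed determinant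
of the matrix with row `i` and column `j` deleted. -/
def cofactor {R : Type*} [CommRing R] :
    {s : ℕ} → Matrix (Fin s) (Fin s) R → Fin s → Fin s → R
  | 0, _, i, _ => i.elim0
  | _ + 1, A, i, j => (-1) ^ (i.val + j.val) * (A.submatrix i.succAbove j.succAbove).det

end SpanForest

/-! Spanning trees containing `F` correspond to spanning trees of the multigraph obtained by
contracting each component of `F`. If L is the Laplacian of that multigraph, the matrix tree theorem
(`det_contractedLap_add_vecMulVec`) gives det(L + u vᵀ) = (∑ u)(∑ v) τ.

For the complete multipartite graph, L = diag(α) - m mᵀ + Nᵀ N, where m = (m_p) and N = (n_{kp}) is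
s × c. Taking u = v = m removes m mᵀ, so n² τ = det(diag(α) + Nᵀ N). Factoring out diag(α) and using
det(1 + QN) = det(1 + NQ) passes from size c to size s. The s × s matrix that results is Z + 1 wᵀ,
with w the vector `shiftRow` (`prod_alpha_mul_det_Z_add`).

Finally Z is singular, with right kernel vector (n - n_k) and left kernel vector (n_k).
`det_add_vecMulVec_mul` therefore expresses det(Z + 1 wᵀ) through any single cofactor of Z, which
produces the denominator n_i (n - n_j). -/

namespace Matrix

open Finset Equiv

/-! ### Cauchy–Binet -/

section CauchyBinet

variable {m e R : Type*} [Fintype m] [DecidableEq m] [Fintype e] [CommRing R]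

/-- The determinant of `A * B` expanded along the rows of `A`. -/
lemma det_mul_eq_sum_prod_mul_det (A : Matrix m e R) (B : Matrix e m R) :
    (A * B).det = ∑ f : m → e, (∏ i, A i (f i)) * (B.submatrix f id).det := by
  rw [← det_transpose]
  simp only [← det_transpose (B.submatrix _ id), det_apply', transpose_apply, mul_apply,
    prod_univ_sum, mul_sum, Fintype.piFinset_univ, submatrix_apply, id_eq]
  rw [Finset.sum_comm]
  refine Finset.sum_congr rfl fun f _ => Finset.sum_congr rfl fun σ _ => ?_
  rw [prod_mul_distrib]
  ring

/-- A form of the Cauchy–Binet formula for `A * Aᵀ`, summed over all lists of columns. -/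
lemma factorial_mul_det_mul_transpose (A : Matrix m e R) :
    ((Fintype.card m).factorial : R) * (A * Aᵀ).det =
      ∑ f : m → e, (A.submatrix id f).det ^ 2 := by
  -- Reindexing the columns by any σ leaves the sum unchanged; summing over all σ then assembles the
  -- signed products into a second copy of the minor.
  have key : ∀ σ : Perm m, (A * Aᵀ).det =
      ∑ f : m → e, (Perm.sign σ : R) * (∏ i, A (σ i) (f i)) * (A.submatrix id f).det := by
    intro σ
    rw [det_mul_eq_sum_prod_mul_det, ← (σ.arrowCongr (Equiv.refl e)).sum_comp]
    refine Finset.sum_congr rfl fun f _ => ?_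
    have h1 : Aᵀ.submatrix ((σ.arrowCongr (Equiv.refl e)) f) id =
        ((A.submatrix id f).submatrix id σ.symm)ᵀ := by
      ext i j; simp [Equiv.arrowCongr]
    rw [h1, det_transpose, det_permute', ← Equiv.prod_comp σ]
    simp [Equiv.arrowCongr]
    ring
  calc _ = ∑ σ : Perm m, (A * Aᵀ).det := by simp [Fintype.card_perm]
    _ = ∑ σ : Perm m, ∑ f : m → e,
          (Perm.sign σ : R) * (∏ i, A (σ i) (f i)) * (A.submatrix id f).det :=
        Finset.sum_congr rfl fun σ _ => key σ
    _ = _ := by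
        rw [Finset.sum_comm]
        refine Finset.sum_congr rfl fun f _ => ?_
        rw [← Finset.sum_mul, sq]
        congr 1
        rw [det_apply']
        rfl

end CauchyBinet

/-! ### Rank one perturbations of singular matrices -/

section RankOne

variable {m K : Type*} [Fintype m] [DecidableEq m] [CommRing K]

/-- Once column k is replaced by u, the perturbation changes the other columns only by multiples of
u. -/
lemma cramer_add_vecMulVec (M : Matrix m m K) (u v : m → K) :
    (M + vecMulVec u v).cramer u = M.cramer u := by
  ext k
  rw [cramer_apply, cramer_apply]
  rw [← det_transpose, ← det_transpose (M.updateCol k u)]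
  refine det_eq_of_forall_row_eq_smul_add_const (fun j => if j = k then 0 else v j) k (by simp) ?_
  intro j i
  by_cases hj : j = k
  · subst hj; simp
  · simp [hj, vecMulVec_apply, mul_comm]

variable [IsDomain K]

/-- The rows of the adjugate are proportional to any vector killed by the matrix. -/
lemma adjugate_mul_eq_of_mulVec_eq_zero {M : Matrix m m K} {x : m → K} (hx : M *ᵥ x = 0)
    (i j k : m) : M.adjugate j i * x k = M.adjugate k i * x j := by
  by_cases h0 : x = 0
  · simp [h0]
  -- The new row is orthogonal to x, so x stays in the kernel; linearity in that row gives the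
  -- claim.
  have h : (M.updateRow i (x k • Pi.single j 1 - x j • Pi.single k 1)).det = 0 := by
    refine exists_mulVec_eq_zero_iff.1 ⟨x, h0, ?_⟩
    ext l
    by_cases hl : l = i
    · subst hl
      simp only [mulVec, updateRow_self]
      change (x k • Pi.single j 1 - x j • Pi.single k 1) ⬝ᵥ x = 0
      simp [sub_dotProduct, smul_dotProduct, mul_comm]
    · simpa [mulVec, hl] using congrFun hx l
  rw [sub_eq_add_neg, ← neg_smul, det_updateRow_add, det_updateRow_smul, det_updateRow_smul] at h
  rw [adjugate_apply, adjugate_apply]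
  linear_combination h

lemma adjugate_mul_eq_of_vecMul_eq_zero {M : Matrix m m K} {y : m → K} (hy : y ᵥ* M = 0)
    (i k l : m) : M.adjugate k i * y l = M.adjugate k l * y i := by
  have := adjugate_mul_eq_of_mulVec_eq_zero (M := Mᵀ) (x := y) (by rwa [mulVec_transpose]) k i l
  simpa [← adjugate_transpose] using this

/-- The determinant of a rank one perturbation of a matrix whose left and right kernels are
given. -/
lemma det_add_vecMulVec_mul {M : Matrix m m K} {x y : m → K} (hx : M *ᵥ x = 0)
    (hy : y ᵥ* M = 0) (u v : m → K) (k l : m) :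
    (M + vecMulVec u v).det * x k * y l = (v ⬝ᵥ x) * (y ⬝ᵥ u) * M.adjugate k l := by
  have h1 : (M + vecMulVec u v) *ᵥ x = (v ⬝ᵥ x) • u := by
    rw [add_mulVec, hx, zero_add, vecMulVec_mulVec]
    simp
  -- Apply the adjugate of the perturbed matrix to `h1`.
  have h2 : (M + vecMulVec u v).det • x = (v ⬝ᵥ x) • M.cramer u := by
    rw [← cramer_add_vecMulVec M u v, cramer_eq_adjugate_mulVec, ← mulVec_smul, ← h1,
      mulVec_mulVec, adjugate_mul, smul_mulVec, one_mulVec]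
  have h3 := congrFun h2 k
  simp only [Pi.smul_apply, smul_eq_mul] at h3
  rw [h3, mul_assoc, mul_assoc]
  congr 1
  rw [cramer_eq_adjugate_mulVec, mulVec, dotProduct, dotProduct, Finset.sum_mul, Finset.sum_mul]
  refine Finset.sum_congr rfl fun i _ => ?_
  rw [mul_right_comm, adjugate_mul_eq_of_vecMul_eq_zero hy]
  ring

end RankOne

end Matrix

/-! ### Edge counts -/

namespace SimpleGraph

open Finset

/-- Each component is a tree, so its degree sum plus 2 is twice its order; sum over components. -/
lemma IsAcyclic.card_edgeSet_add_card_connectedComponent {V : Type*} [Finite V]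
    {F : SimpleGraph V} (hF : F.IsAcyclic) :
    Nat.card F.edgeSet + Nat.card F.ConnectedComponent = Nat.card V := by
  classical
  have := Fintype.ofFinite V
  have hC : ∀ C : F.ConnectedComponent,
      ∑ v : V with F.connectedComponentMk v = C, F.degree v + 2 =
        2 * #{v : V | F.connectedComponentMk v = C} := by
    intro C
    have h1 := (hF.isTree_connectedComponent C).card_edgeFinset
    have h2 := C.toSimpleGraph.sum_degrees_eq_twice_card_edges
    have h3 : ∀ v : C, C.toSimpleGraph.degree v = F.degree v := by
      intro v
      have h := F.degree_induce_of_neighborSet_subset (s := C.supp) (v := v) ?_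
      · convert h <;> rfl
      intro w hw
      have hv : F.connectedComponentMk v = C := v.2
      rw [ConnectedComponent.mem_supp_iff, ← hv]
      exact ConnectedComponent.sound hw.symm.reachable
    have h4 : ∑ v : C, C.toSimpleGraph.degree v =
        ∑ v : V with F.connectedComponentMk v = C, F.degree v := by
      rw [Finset.sum_congr rfl fun v _ => h3 v]
      exact Finset.sum_subtype _ (by simp; intros; rfl) (fun v => F.degree v) |>.symm
    have h5 : Fintype.card C = #{v : V | F.connectedComponentMk v = C} :=
      Fintype.card_of_subtype _ (by simp; intros; rfl)
    omega
  have h := Finset.sum_congr (rfl : (univ : Finset F.ConnectedComponent) = univ) fun C _ => hC C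
  have h0 : ∑ C : F.ConnectedComponent, ∑ v : V with F.connectedComponentMk v = C, F.degree v =
      ∑ v, F.degree v := by
    convert sum_fiberwise univ F.connectedComponentMk fun v => F.degree v
  rw [sum_add_distrib, h0, ← mul_sum, F.sum_degrees_eq_twice_card_edges] at h
  have h6 : ∑ C : F.ConnectedComponent, #{v : V | F.connectedComponentMk v = C} =
      Fintype.card V :=
    (card_eq_sum_card_fiberwise (f := F.connectedComponentMk) (fun _ _ => mem_univ _)).symm
  rw [h6] at h
  simp only [sum_const, card_univ, smul_eq_mul] at h
  rw [Nat.card_eq_fintype_card, Nat.card_eq_fintype_card, Nat.card_eq_fintype_card,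
    ← edgeFinset_card]
  omega

lemma two_mul_sum_edgeFinset {V R : Type*} [Fintype V] [CommRing R] (G : SimpleGraph V)
    [DecidableRel G.Adj] [Fintype G.edgeSet] (φ : Sym2 V → R) :
    2 * ∑ e ∈ G.edgeFinset, φ e = ∑ a, ∑ b, if G.Adj a b then φ s(a, b) else 0 := by
  classical
  have h1 : ∑ d : G.Dart, φ d.edge = 2 * ∑ e ∈ G.edgeFinset, φ e := by
    rw [← sum_fiberwise_of_maps_to (s := univ) (t := G.edgeFinset) (g := Dart.edge)
      (fun d _ => by rw [mem_edgeFinset]; exact d.edge_mem), mul_sum]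
    refine Finset.sum_congr rfl fun e he => ?_
    rw [Finset.sum_congr rfl (g := fun _ => φ e) (by simp +contextual), sum_const,
      G.dart_edge_fiber_card e (by simpa using he)]
    simp
  rw [← h1, ← sum_product', ← sum_filter]
  refine sum_bij' (fun d _ => (d.fst, d.snd)) (fun x h => ⟨x, (mem_filter.1 h).2⟩) ?_ ?_ ?_ ?_ ?_
    <;> simp
  intro d
  rfl

end SimpleGraph

namespace SpanForest

open Finset Matrix
open scoped Classical

/-! ### Matrix tree theorem for a contracted forest -/

section ContractedLaplacian

variable {V : Type*} (G F : SimpleGraph V)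

/-- The indicator function of a component. -/
noncomputable def compInd (p : F.ConnectedComponent) (v : V) : ℤ :=
  if F.connectedComponentMk v = p then 1 else 0

/-- The Laplacian of the multigraph obtained from `G` by contracting the components of `F`. -/
noncomputable def contractedLap [Fintype V] :
    Matrix F.ConnectedComponent F.ConnectedComponent ℤ :=
  of fun p q => ∑ a, ∑ b, if G.Adj a b then
    compInd F p a * (compInd F q a - compInd F q b) else 0

/-- The oriented incidence matrix of the contracted multigraph, with an extra column supported
at the component `r`. -/
noncomputable def augIncMatrix (r : F.ConnectedComponent) :
    Matrix F.ConnectedComponent (Option ↥(G.edgeSet \ F.edgeSet)) ℤ :=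
  of fun p o => o.elim (if p = r then 1 else 0)
    fun e => compInd F p e.1.out.1 - compInd F p e.1.out.2

variable {G F}

lemma compInd_eq_of_adj {a b : V} (h : F.Adj a b) (p : F.ConnectedComponent) :
    compInd F p a = compInd F p b := by
  rw [compInd, compInd, SimpleGraph.ConnectedComponent.sound h.reachable]

lemma out_eq_or (a b : V) :
    (s(a, b).out.1 = a ∧ s(a, b).out.2 = b) ∨ (s(a, b).out.1 = b ∧ s(a, b).out.2 = a) := by
  have h : s((s(a, b)).out.1, (s(a, b)).out.2) = s(a, b) := Quot.out_eq _
  rwa [Sym2.eq_iff] at h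

lemma adj_out_of_mem_edgeSet {T : SimpleGraph V} {e : Sym2 V} (h : e ∈ T.edgeSet) :
    T.Adj e.out.1 e.out.2 := by
  have h' : s(e.out.1, e.out.2) = e := Quot.out_eq _
  rwa [← h', SimpleGraph.mem_edgeSet] at h

/-- Edges of `F` contribute zero, so the sum extends to all edges of `G`; the arbitrary orientations
cancel in the products. The extra column gives the rank one term. -/
lemma augIncMatrix_mul_transpose [Fintype V] (r : F.ConnectedComponent) :
    augIncMatrix G F r * (augIncMatrix G F r)ᵀ =
      contractedLap G F + vecMulVec (Pi.single r 1) (Pi.single r 1) := by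
  ext p q
  let φ : Sym2 V → ℤ := fun e => (compInd F p e.out.1 - compInd F p e.out.2) *
    (compInd F q e.out.1 - compInd F q e.out.2)
  have hφ : ∀ a b, φ s(a, b) = (compInd F p a - compInd F p b) *
      (compInd F q a - compInd F q b) := by
    intro a b
    rcases out_eq_or a b with ⟨h1, h2⟩ | ⟨h1, h2⟩ <;> simp only [φ, h1, h2]
    ring
  have h1 : ∑ e : ↥(G.edgeSet \ F.edgeSet), φ e.1 = ∑ e ∈ G.edgeFinset, φ e := by
    rw [← Finset.sum_subtype (G.edgeFinset \ F.edgeFinset) (by simp) φ]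
    refine Finset.sum_subset sdiff_subset fun e he hne => ?_
    have : e ∈ F.edgeSet := by simpa using by simpa [he] using hne
    simp [φ, compInd_eq_of_adj (adj_out_of_mem_edgeSet this)]
  have h2 := G.two_mul_sum_edgeFinset φ
  have h3 : ∑ a, ∑ b, (if G.Adj a b then φ s(a, b) else 0) = 2 * contractedLap G F p q := by
    rw [two_mul]
    nth_rw 2 [contractedLap]
    rw [contractedLap, of_apply]
    nth_rw 3 [sum_comm]
    rw [← sum_add_distrib]
    refine Finset.sum_congr rfl fun a _ => ?_
    rw [← sum_add_distrib]
    refine Finset.sum_congr rfl fun b _ => ?_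
    by_cases h : G.Adj a b
    · simp only [h, h.symm, if_true, hφ]
      ring
    · have h' : ¬ G.Adj b a := fun k => h k.symm
      simp [h, h']
  have h4 : ∑ e : ↥(G.edgeSet \ F.edgeSet), φ e.1 = contractedLap G F p q := by
    rw [h1]; rw [h3] at h2; linarith
  rw [mul_apply, Fintype.sum_option, Matrix.add_apply, ← h4, add_comm, vecMulVec_apply]
  simp only [augIncMatrix, of_apply, transpose_apply, Option.elim, φ, Pi.single_apply]

/-- The columns of the augmented incidence matrix that belong to the edges of `T`, and the
extra column. -/
def treeColumns (G F T : SimpleGraph V) : Set (Option ↥(G.edgeSet \ F.edgeSet)) :=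
  {o | ∀ e ∈ o, e.1 ∈ T.edgeSet}

@[simp]
lemma none_mem_treeColumns {T : SimpleGraph V} : none ∈ treeColumns G F T := by
  simp [treeColumns]

@[simp]
lemma some_mem_treeColumns {T : SimpleGraph V} {e : ↥(G.edgeSet \ F.edgeSet)} :
    some e ∈ treeColumns G F T ↔ e.1 ∈ T.edgeSet :=
  ⟨fun h => h e rfl, fun h e' he => by obtain rfl := Option.some.inj he; exact h⟩

lemma treeColumns_injOn : Set.InjOn (treeColumns G F) {T | T ≤ G ∧ F ≤ T} := by
  have key : ∀ T ∈ {T | T ≤ G ∧ F ≤ T}, ∀ T' ∈ {T | T ≤ G ∧ F ≤ T},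
      treeColumns G F T = treeColumns G F T' → T ≤ T' := by
    rintro T hT T' hT' h
    rw [← SimpleGraph.edgeSet_subset_edgeSet]
    intro e he
    by_cases heF : e ∈ F.edgeSet
    · exact SimpleGraph.edgeSet_subset_edgeSet.2 hT'.2 heF
    · have : some ⟨e, SimpleGraph.edgeSet_subset_edgeSet.2 hT.1 he, heF⟩ ∈ treeColumns G F T := by
        simpa using he
      rw [h] at this
      simpa using this
  exact fun T hT T' hT' h => le_antisymm (key T hT T' hT' h) (key T' hT' T hT h.symm)

/-- A tree has (|V| - 1) - (|V| - c) = c - 1 edges outside `F`; the extra column makes the minor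
square. -/
lemma ncard_treeColumns [Finite V] {T : SimpleGraph V} (hF : F.IsAcyclic) (hT : T.IsTree)
    (hTG : T ≤ G) (hFT : F ≤ T) :
    (treeColumns G F T).ncard = Nat.card F.ConnectedComponent := by
  have h1 : treeColumns G F T = insert none (some '' {e | e.1 ∈ T.edgeSet}) := by
    ext o
    cases o <;> simp
  have h2 : ({e | e.1 ∈ T.edgeSet} : Set ↥(G.edgeSet \ F.edgeSet)).ncard =
      (T.edgeSet \ F.edgeSet).ncard := by
    rw [← Set.ncard_image_of_injective _ Subtype.val_injective]
    congr 1
    ext e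
    have : e ∈ T.edgeSet → e ∈ G.edgeSet := fun h => SimpleGraph.edgeSet_subset_edgeSet.2 hTG h
    simp only [Set.mem_image, Set.mem_ofPred_eq, Subtype.exists, exists_and_right, exists_eq_right,
      Set.mem_sdiff]
    tauto
  rw [h1, Set.ncard_insert_of_notMem (by simp) (Set.toFinite _),
    Set.ncard_image_of_injective _ (Option.some_injective _), h2]
  have h3 := Set.ncard_sdiff_add_ncard_of_subset (SimpleGraph.edgeSet_subset_edgeSet.2 hFT)
    (Set.toFinite _)
  have h4 := hF.card_edgeSet_add_card_connectedComponent
  have h5 := (SimpleGraph.isTree_iff_connected_and_card.1 hT).2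
  rw [Nat.card_coe_set_eq] at h4 h5
  omega

/-- The columns span over ℤ: the extra column is the basis vector at `r`, and each edge of `T`
carries the basis vector of one endpoint's component to that of the other. -/
lemma isUnit_det_of_range_eq [Fintype V] [Fintype F.ConnectedComponent]
    {T : SimpleGraph V} {r : F.ConnectedComponent}
    {f : F.ConnectedComponent → Option ↥(G.edgeSet \ F.edgeSet)} (hT : T.IsTree) (hTG : T ≤ G)
    (hf : Set.range f = treeColumns G F T) :
    IsUnit ((augIncMatrix G F r).submatrix id f).det := by
  rw [← isUnit_iff_isUnit_det, ← mulVec_surjective_iff_isUnit]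
  set B := (augIncMatrix G F r).submatrix id f with hB
  let R : Submodule ℤ (F.ConnectedComponent → ℤ) := LinearMap.range B.mulVecLin
  have hcol : ∀ o ∈ treeColumns G F T, (fun p => augIncMatrix G F r p o) ∈ R := by
    intro o ho
    rw [← hf] at ho
    obtain ⟨i, rfl⟩ := ho
    refine ⟨Pi.single i 1, ?_⟩
    ext p
    simp [B]
  have hstep : ∀ a b, T.Adj a b → (fun p => compInd F p a) ∈ R → (fun p => compInd F p b) ∈ R := by
    intro a b hab ha
    by_cases hF : F.Adj a b
    · simpa only [compInd_eq_of_adj hF] using ha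
    · have h := hcol (some ⟨s(a, b), hTG hab, hF⟩) (by simpa using hab)
      simp only [augIncMatrix, of_apply, Option.elim] at h
      rcases out_eq_or a b with ⟨h1, h2⟩ | ⟨h1, h2⟩ <;> simp only [h1, h2] at h
      · convert R.sub_mem ha h using 1
        ext p; simp
      · convert R.add_mem ha h using 1
        ext p; simp
  have hwalk : ∀ u v, T.Walk u v → (fun p => compInd F p u) ∈ R → (fun p => compInd F p v) ∈ R := by
    intro u v w
    induction w with
    | nil => exact id
    | cons h _ ih => exact fun hu => ih (hstep _ _ h hu)
  have hall : ∀ v, (fun p => compInd F p v) ∈ R := by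
    intro v
    obtain ⟨v₀, hv₀⟩ := r.exists_rep
    obtain ⟨w⟩ := hT.connected.preconnected v₀ v
    refine hwalk _ _ w ?_
    convert hcol none (by simp) using 2 with p
    simp only [compInd, augIncMatrix, of_apply, Option.elim]
    change F.connectedComponentMk v₀ = r at hv₀
    rw [hv₀]
    simp only [eq_comm]
  intro y
  have hy : y ∈ R := by
    rw [pi_eq_sum_univ y]
    refine R.sum_mem fun p _ => R.smul_mem _ ?_
    obtain ⟨v, hv⟩ := p.exists_rep
    change F.connectedComponentMk v = p at hv
    convert hall v using 2
    rw [compInd, hv]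
  obtain ⟨x, hx⟩ := hy
  exact ⟨x, hx⟩

/-- A nonzero minor has trivial left kernel, which forces the chosen edges together with `F` to be
connected; counting edges then forces a tree. -/
lemma exists_isTree_of_det_ne_zero [Fintype V] [Fintype F.ConnectedComponent]
    (hF : F.IsAcyclic) (hFG : F ≤ G)
    {r : F.ConnectedComponent} {f : F.ConnectedComponent → Option ↥(G.edgeSet \ F.edgeSet)}
    (hdet : ((augIncMatrix G F r).submatrix id f).det ≠ 0) :
    ∃ T : SimpleGraph V, T.IsTree ∧ T ≤ G ∧ F ≤ T ∧ Set.range f = treeColumns G F T := by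
  have hker : ∀ y : F.ConnectedComponent → ℤ,
      (∀ o ∈ Set.range f, ∑ p, y p * augIncMatrix G F r p o = 0) → y = 0 := by
    intro y hy
    by_contra h0
    refine hdet (exists_vecMul_eq_zero_iff.1 ⟨y, h0, ?_⟩)
    ext i
    exact hy (f i) ⟨i, rfl⟩
  have hnone : ∀ y : F.ConnectedComponent → ℤ, ∑ p, y p * augIncMatrix G F r p none = y r := by
    intro y
    simp [augIncMatrix]
  have hsome : ∀ (y : F.ConnectedComponent → ℤ) e, ∑ p, y p * augIncMatrix G F r p (some e) =
      y (F.connectedComponentMk e.1.out.1) - y (F.connectedComponentMk e.1.out.2) := by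
    intro y e
    simp [augIncMatrix, compInd, mul_sub, sum_sub_distrib]
  have hmem : none ∈ Set.range f := by
    by_contra hn
    -- The all-ones vector kills every edge column.
    have := hker 1 fun o ho => by
      cases o with
      | none => exact absurd ho hn
      | some e => rw [hsome]; simp
    simpa using congrFun this r
  let A : Set ↥(G.edgeSet \ F.edgeSet) := {e | some e ∈ Set.range f}
  let T : SimpleGraph V := F ⊔ SimpleGraph.fromEdgeSet (Subtype.val '' A)
  have hTe : T.edgeSet = F.edgeSet ∪ Subtype.val '' A := by
    simp only [T, SimpleGraph.edgeSet_sup, SimpleGraph.edgeSet_fromEdgeSet]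
    congr 1
    rw [sdiff_eq_left, Set.disjoint_left]
    rintro _ ⟨e, -, rfl⟩
    exact G.not_isDiag_of_mem_edgeSet e.2.1
  have hFT : F ≤ T := le_sup_left
  have hTG : T ≤ G := by
    rw [← SimpleGraph.edgeSet_subset_edgeSet, hTe]
    refine Set.union_subset (SimpleGraph.edgeSet_subset_edgeSet.2 hFG) ?_
    rintro _ ⟨e, -, rfl⟩
    exact e.2.1
  obtain ⟨v₀, hv₀⟩ := r.exists_rep
  change F.connectedComponentMk v₀ = r at hv₀
  have hreach : ∀ v, T.Reachable v₀ v := by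
    intro v
    -- The indicator of the components of `F` not joined to `r` in `T` lies in the left kernel.
    have h0 := hker (fun p => if p.map (SimpleGraph.Hom.ofLE hFT) = T.connectedComponentMk v₀
      then 0 else 1) fun o ho => by
        cases o with
        | none => rw [hnone, ← hv₀]; simp
        | some e =>
          have hadj : T.Adj e.1.out.1 e.1.out.2 := adj_out_of_mem_edgeSet (by
            rw [hTe]; exact Or.inr ⟨e, ho, rfl⟩)
          rw [hsome]
          simp [SimpleGraph.ConnectedComponent.sound hadj.reachable]
    have h1 := congrFun h0 (F.connectedComponentMk v)
    have h2 : T.connectedComponentMk v = T.connectedComponentMk v₀ := by simpa using h1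
    exact (SimpleGraph.ConnectedComponent.exact h2).symm
  have hconn : T.Connected :=
    { preconnected := fun u v => (hreach u).symm.trans (hreach v)
      nonempty := ⟨v₀⟩ }
  -- One of the at most c chosen columns is the extra one, leaving at most c - 1 edges.
  have hA : A.ncard + 1 ≤ Nat.card F.ConnectedComponent := by
    have h1 : insert none (some '' A) ⊆ Set.range f := by
      rintro o (rfl | ⟨e, he, rfl⟩)
      · exact hmem
      · exact he
    have h2 := Set.ncard_le_ncard h1 (Set.toFinite _)
    rw [Set.ncard_insert_of_notMem (by simp) (Set.toFinite _),
      Set.ncard_image_of_injective _ (Option.some_injective _)] at h2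
    refine h2.trans ?_
    rw [← Set.image_univ, ← Set.ncard_univ]
    exact Set.ncard_image_le (Set.toFinite _)
  refine ⟨T, ?_, hTG, hFT, ?_⟩
  · rw [SimpleGraph.isTree_iff_connected_and_card]
    refine ⟨hconn, ?_⟩
    have h1 := hconn.card_vert_le_card_edgeSet_add_one
    have h2 := hF.card_edgeSet_add_card_connectedComponent
    have h3 := Set.ncard_union_le F.edgeSet (Subtype.val '' A)
    rw [← hTe, Set.ncard_image_of_injective _ Subtype.val_injective] at h3
    rw [Nat.card_coe_set_eq] at h1 h2 ⊢
    omega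
  · ext o
    cases o with
    | none => simpa using hmem
    | some e =>
      have heF := e.2.2
      simp only [some_mem_treeColumns, hTe, Set.mem_union, heF, false_or, Subtype.val_injective.mem_set_image]
      rfl

lemma ncard_setOf_range_eq {α β : Type*} [Fintype α] {S : Set β} (hS : S.Finite)
    (h : S.ncard = Fintype.card α) :
    {f : α → β | Set.range f = S}.ncard = (Fintype.card α).factorial := by
  have := hS.fintype
  have hc : Fintype.card α = Fintype.card S := by
    rw [← h, ← Nat.card_coe_set_eq, Nat.card_eq_fintype_card]
  rw [← Fintype.card_equiv (Fintype.equivOfCardEq hc), ← Nat.card_eq_fintype_card,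
    ← Nat.card_coe_set_eq]
  refine (Nat.card_eq_of_bijective
    (fun g : α ≃ S => (⟨fun a => g a, ?_⟩ : {f : α → β | Set.range f = S})) ⟨?_, ?_⟩).symm
  · change Set.range (Subtype.val ∘ g) = S
    rw [Set.range_comp, g.surjective.range_eq]
    simp
  · intro g g' hg
    ext a
    exact congrFun (congrArg Subtype.val hg) a
  · rintro ⟨f, hf⟩
    have hf' : Set.range f = S := hf
    let f' : α → S := fun a => ⟨f a, hf' ▸ ⟨a, rfl⟩⟩
    have hs : Function.Surjective f' := by
      rintro ⟨b, hb⟩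
      rw [← hf'] at hb
      obtain ⟨a, rfl⟩ := hb
      exact ⟨a, rfl⟩
    exact ⟨Equiv.ofBijective f' ((Fintype.bijective_iff_surjective_and_card f').2 ⟨hs, hc⟩), rfl⟩

/-- The matrix tree theorem for the contraction of a forest. -/
theorem det_contractedLap_add_vecMulVec_single [Fintype V] [Fintype F.ConnectedComponent]
    (hF : F.IsAcyclic) (hFG : F ≤ G)
    (r : F.ConnectedComponent) :
    (contractedLap G F + vecMulVec (Pi.single r 1) (Pi.single r 1)).det =
      (tau G F : ℤ) := by
  have hbinet := factorial_mul_det_mul_transpose (augIncMatrix G F r)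
  rw [augIncMatrix_mul_transpose r] at hbinet
  let S : Finset (SimpleGraph V) :=
    Set.toFinset {T : SimpleGraph V | IsSpanningTree G T ∧ F ≤ T}
  have hS : ∀ T, T ∈ S ↔ (T ≤ G ∧ T.IsTree) ∧ F ≤ T := by
    intro T
    rw [Set.mem_toFinset]
    rfl
  have htau : tau G F = #S := by
    rw [tau, Set.ncard_eq_toFinset_card']
  have hterm : ∀ f : F.ConnectedComponent → Option ↥(G.edgeSet \ F.edgeSet),
      ((augIncMatrix G F r).submatrix id f).det ^ 2 =
        ∑ T ∈ S, if Set.range f = treeColumns G F T then 1 else 0 := by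
    intro f
    by_cases hex : ∃ T ∈ S, Set.range f = treeColumns G F T
    · obtain ⟨T, hTS, hT⟩ := hex
      have hT' := (hS T).1 hTS
      rw [Int.isUnit_sq (isUnit_det_of_range_eq hT'.1.2 hT'.1.1 hT), hT, sum_eq_single_of_mem T hTS,
        if_pos rfl]
      intro T₂ hT₂ hne
      refine if_neg fun h => hne ?_
      have hT₂' := (hS T₂).1 hT₂
      exact treeColumns_injOn ⟨hT₂'.1.1, hT₂'.2⟩ ⟨hT'.1.1, hT'.2⟩ h.symm
    · rw [sum_eq_zero fun T hT => if_neg fun h => hex ⟨T, hT, h⟩]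
      by_contra hne
      obtain ⟨T, h1, h2, h3, h4⟩ := exists_isTree_of_det_ne_zero hF hFG
        (fun h => hne (by rw [h]; simp))
      exact hex ⟨T, (hS T).2 ⟨⟨h2, h1⟩, h3⟩, h4⟩
  -- Each tree is counted once per ordering of its c columns; this factorial cancels the one from
  -- Cauchy–Binet.
  have hcount : ∀ T ∈ S, (∑ f : F.ConnectedComponent → Option ↥(G.edgeSet \ F.edgeSet),
      if Set.range f = treeColumns G F T then (1 : ℤ) else 0) =
        (Fintype.card F.ConnectedComponent).factorial := by
    intro T hT
    have hT' := (hS T).1 hT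
    have h := ncard_treeColumns hF hT'.1.2 hT'.1.1 hT'.2
    rw [Nat.card_eq_fintype_card] at h
    rw [sum_boole, ← ncard_setOf_range_eq (Set.toFinite _) h, Set.ncard_eq_toFinset_card',
      Set.toFinset_ofPred]
  rw [Finset.sum_congr rfl fun f _ => hterm f, sum_comm, Finset.sum_congr rfl hcount, sum_const,
    nsmul_eq_mul, mul_comm] at hbinet
  rw [htau]
  exact mul_right_cancel₀ (by exact_mod_cast (Nat.factorial_ne_zero _)) hbinet

lemma sum_compInd [Fintype F.ConnectedComponent] (v : V) : ∑ p, compInd F p v = 1 := by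
  simp [compInd]

lemma contractedLap_mulVec_one [Fintype V] [Fintype F.ConnectedComponent] : contractedLap G F *ᵥ 1 = 0 := by
  ext p
  simp only [mulVec, dotProduct, contractedLap, of_apply, Pi.one_apply, mul_one, Pi.zero_apply]
  rw [sum_comm]
  refine sum_eq_zero fun a _ => ?_
  rw [sum_comm]
  refine sum_eq_zero fun b _ => ?_
  split_ifs
  · rw [← mul_sum, sum_sub_distrib, sum_compInd, sum_compInd, sub_self, mul_zero]
  · simp

lemma one_vecMul_contractedLap [Fintype V] [Fintype F.ConnectedComponent] : 1 ᵥ* contractedLap G F = 0 := by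
  ext q
  simp only [vecMul, dotProduct, contractedLap, of_apply, Pi.one_apply, one_mul, Pi.zero_apply]
  have h : ∀ a b, (∑ p, if G.Adj a b then compInd F p a * (compInd F q a - compInd F q b) else 0) =
      (if G.Adj a b then compInd F q a else 0) - if G.Adj a b then compInd F q b else 0 := by
    intro a b
    split_ifs
    · rw [← sum_mul, sum_compInd, one_mul]
    · simp
  rw [sum_comm, Finset.sum_congr rfl fun a _ => sum_comm]
  simp only [h, sum_sub_distrib]
  rw [sub_eq_zero, sum_comm]
  simp only [G.adj_comm]

/-- Both kernels contain the all-ones vector, so the determinant is (∑ v)(∑ u) times a diagonal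
cofactor, which the case u = v = e_r identifies as τ. -/
theorem det_contractedLap_add_vecMulVec [Fintype V] [Fintype F.ConnectedComponent]
    [Nonempty V] (hF : F.IsAcyclic) (hFG : F ≤ G) (u v : F.ConnectedComponent → ℤ) :
    (contractedLap G F + vecMulVec u v).det = (∑ p, v p) * (∑ p, u p) * (tau G F : ℤ) := by
  obtain ⟨r⟩ : Nonempty F.ConnectedComponent := inferInstance
  have key := fun u v => det_add_vecMulVec_mul (contractedLap_mulVec_one (G := G) (F := F))
    one_vecMul_contractedLap u v r r
  have h := key (Pi.single r 1) (Pi.single r 1)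
  rw [det_contractedLap_add_vecMulVec_single hF hFG] at h
  have h' := key u v
  simp only [Pi.one_apply, mul_one, dotProduct_one, one_dotProduct, sum_pi_single', mem_univ,
    if_true, one_mul] at h h'
  rw [h', h]

end ContractedLaplacian

end SpanForest

namespace SpanForest

open Finset Matrix
open scoped Classical

/-! ### The complete multipartite graph -/

section Multipartite

variable {s : ℕ} {X : Fin s → Type*} {F : SimpleGraph (Σ i, X i)}

lemma partSize_eq_sum [Fintype (Σ i, X i)] (i : Fin s) :
    (partSize X i : ℚ) = ∑ v : Σ i, X i, if v.1 = i then 1 else 0 := by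
  rw [partSize, Set.ncard_eq_toFinset_card', sum_boole]
  congr 2
  ext v
  rw [Set.mem_toFinset]
  simp [part]

lemma compSize_eq_sum [Fintype (Σ i, X i)] (p : F.ConnectedComponent) :
    (compSize p : ℚ) = ∑ v, (compInd F p v : ℚ) := by
  simp only [compInd, Int.cast_ite, Int.cast_one, Int.cast_zero]
  rw [compSize, Set.ncard_eq_toFinset_card', sum_boole]
  congr 2
  ext v
  simp

lemma interSize_eq_sum [Fintype (Σ i, X i)] (i : Fin s) (p : F.ConnectedComponent) :
    (interSize i p : ℚ) = ∑ v, (if v.1 = i then 1 else 0) * (compInd F p v : ℚ) := by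
  simp only [compInd, Int.cast_ite, Int.cast_one, Int.cast_zero, ite_zero_mul_ite_zero, mul_one]
  rw [interSize, Set.ncard_eq_toFinset_card', sum_boole]
  congr 2
  ext v
  rw [Set.mem_toFinset]
  simp [part]

lemma sum_interSize_eq_compSize [Finite (Σ i, X i)] (p : F.ConnectedComponent) :
    ∑ i, (interSize i p : ℚ) = compSize p := by
  have := Fintype.ofFinite (Σ i, X i)
  simp only [interSize_eq_sum, compSize_eq_sum]
  rw [sum_comm]
  simp

lemma sum_interSize_eq_partSize [Fintype (Σ i, X i)] (i : Fin s) :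
    ∑ p : F.ConnectedComponent, (interSize i p : ℚ) = partSize X i := by
  simp only [interSize_eq_sum, partSize_eq_sum]
  rw [sum_comm]
  refine Finset.sum_congr rfl fun v _ => ?_
  rw [← mul_sum]
  have h : ∑ p, (compInd F p v : ℚ) = 1 := by exact_mod_cast sum_compInd (F := F) v
  rw [h, mul_one]

lemma order_eq_sum : (order X : ℚ) = ∑ i, (partSize X i : ℚ) := by
  simp [order]

lemma sum_compSize [Fintype (Σ i, X i)] :
    ∑ p : F.ConnectedComponent, (compSize p : ℚ) = order X := by
  simp only [← sum_interSize_eq_compSize, order_eq_sum, ← sum_interSize_eq_partSize (F := F)]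
  exact sum_comm

lemma alpha_eq_sum_interSize [Finite (Σ i, X i)] (p : F.ConnectedComponent) :
    alpha p = ∑ i, (interSize i p : ℚ) * ((order X : ℚ) - partSize X i) := by
  rw [alpha, ← sum_interSize_eq_compSize, mul_sum, ← sum_sub_distrib]
  exact Finset.sum_congr rfl fun i _ => by ring

lemma alpha_eq_sum_partSize (p : F.ConnectedComponent) :
    alpha p = ∑ i, (partSize X i : ℚ) * ((compSize p : ℚ) - interSize i p) := by
  rw [alpha, order_eq_sum, sum_mul, ← sum_sub_distrib]
  exact Finset.sum_congr rfl fun i _ => by ring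

lemma partSize_pos [∀ i, Finite (X i)] [∀ i, Nonempty (X i)] (i : Fin s) : 0 < partSize X i := by
  obtain ⟨x⟩ : Nonempty (X i) := inferInstance
  exact (Set.ncard_pos (Set.toFinite _)).2 ⟨⟨i, x⟩, rfl⟩

lemma partSize_lt_order [∀ i, Finite (X i)] [∀ i, Nonempty (X i)] (hs : 2 ≤ s) (i : Fin s) :
    partSize X i < order X := by
  have : Nontrivial (Fin s) := Fin.nontrivial_iff_two_le.2 hs
  obtain ⟨j, hj⟩ := exists_ne i
  exact single_lt_sum hj (mem_univ i) (mem_univ j) (partSize_pos j) fun _ _ _ => Nat.zero_le _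

lemma alpha_pos [∀ i, Finite (X i)] [∀ i, Nonempty (X i)] (hs : 2 ≤ s)
    (p : F.ConnectedComponent) : 0 < alpha p := by
  rw [alpha_eq_sum_interSize]
  have hx : ∀ i, (0 : ℚ) < (order X : ℚ) - partSize X i := fun i =>
    sub_pos.2 (by exact_mod_cast partSize_lt_order hs i)
  obtain ⟨v, hv⟩ := p.exists_rep
  refine sum_pos' (fun i _ => mul_nonneg (Nat.cast_nonneg _) (hx i).le)
    ⟨v.1, mem_univ _, mul_pos ?_ (hx _)⟩
  have h : 0 < interSize v.1 p := (Set.ncard_pos (Set.toFinite _)).2 ⟨v, rfl, hv⟩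
  exact_mod_cast h

lemma contractedLap_multipartite_apply [Fintype (Σ i, X i)] (p q : F.ConnectedComponent) :
    (contractedLap (K X) F p q : ℚ) = (if p = q then alpha p else 0) -
      ((compSize p : ℚ) * compSize q - ∑ i, (interSize i p : ℚ) * interSize i q) := by
  let δ : (Σ i, X i) → (Σ i, X i) → ℚ := fun a b => ∑ i, (if a.1 = i then 1 else 0) *
    (if b.1 = i then 1 else 0)
  have hδ : ∀ a b, δ a b = if a.1 = b.1 then 1 else 0 := by
    intro a b
    simp [δ, eq_comm]
  have hcard : (order X : ℚ) = ∑ b : Σ i, X i, 1 := by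
    rw [order_eq_sum]
    simp only [partSize_eq_sum]
    rw [sum_comm]
    simp
  have h1 : (contractedLap (K X) F p q : ℚ) = ∑ a, ∑ b, (1 - δ a b) *
      ((compInd F p a : ℚ) * (compInd F q a - compInd F q b)) := by
    simp only [contractedLap, of_apply, Int.cast_sum]
    refine Finset.sum_congr rfl fun a _ => Finset.sum_congr rfl fun b _ => ?_
    rw [hδ]
    by_cases h : a.1 = b.1 <;> simp [h]
  have h2 : (if p = q then alpha p else 0) = ∑ a, ∑ b, (1 - δ a b) *
      ((compInd F p a : ℚ) * compInd F q a) := by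
    have h3 : ∀ a, (compInd F p a : ℚ) * compInd F q a = if p = q then compInd F p a else 0 := by
      intro a
      simp only [compInd]
      split_ifs <;> simp_all
    simp only [h3]
    split_ifs with hpq
    · rw [alpha]
      have h4 : ∑ i, (partSize X i : ℚ) * interSize i p = ∑ a, ∑ b, δ a b * compInd F p a := by
        simp only [partSize_eq_sum, interSize_eq_sum, sum_mul_sum]
        simp only [δ, sum_mul]
        rw [Finset.sum_congr rfl fun i _ => sum_comm, sum_comm]
        refine Finset.sum_congr rfl fun a _ => ?_
        rw [sum_comm]
        exact Finset.sum_congr rfl fun b _ => Finset.sum_congr rfl fun i _ => by ring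
      rw [h4, compSize_eq_sum, hcard, mul_comm, sum_mul_sum, ← sum_sub_distrib]
      refine Finset.sum_congr rfl fun a _ => ?_
      rw [← sum_sub_distrib]
      exact Finset.sum_congr rfl fun b _ => by ring
    · simp
  have h5 : ∑ i, (interSize i p : ℚ) * interSize i q =
      ∑ a, ∑ b, δ a b * ((compInd F p a : ℚ) * compInd F q b) := by
    simp only [interSize_eq_sum, sum_mul_sum]
    simp only [δ, sum_mul]
    rw [sum_comm]
    refine Finset.sum_congr rfl fun a _ => ?_
    rw [sum_comm]
    exact Finset.sum_congr rfl fun b _ => Finset.sum_congr rfl fun i _ => by ring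
  rw [h1, h2, h5, compSize_eq_sum, compSize_eq_sum, sum_mul_sum, ← sum_sub_distrib,
    ← sum_sub_distrib]
  refine Finset.sum_congr rfl fun a _ => ?_
  rw [← sum_sub_distrib, ← sum_sub_distrib]
  exact Finset.sum_congr rfl fun b _ => by ring

lemma cofactor_eq_adjugate {R : Type*} [CommRing R] {s : ℕ} (A : Matrix (Fin s) (Fin s) R)
    (i j : Fin s) : cofactor A i j = A.adjugate j i := by
  cases s with
  | zero => exact i.elim0
  | succ s => rw [cofactor, adjugate_fin_succ_eq_det_submatrix]

variable {c : ℕ} (T : Fin c ≃ F.ConnectedComponent)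

lemma Z_apply (k l : Fin s) : Z T k l = (1 : Matrix (Fin s) (Fin s) ℚ) k l -
    ∑ p, (interSize l (T p) : ℚ) * ((compSize (T p) : ℚ) - interSize k (T p)) / alpha (T p) := by
  simp [Z]

/-- Rests on α_p = ∑ n_{lp} (n - n_l); the left kernel uses α_p = ∑ n_k (m_p - n_{kp}) instead. -/
lemma Z_mulVec [∀ i, Finite (X i)] [∀ i, Nonempty (X i)] (hs : 2 ≤ s) :
    Z T *ᵥ (fun k => (order X : ℚ) - partSize X k) = 0 := by
  have := Fintype.ofFinite (Σ i, X i)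
  ext k
  simp only [mulVec, dotProduct, Z_apply, sub_mul, sum_sub_distrib, one_apply, ite_mul, one_mul,
    zero_mul, sum_ite_eq, mem_univ, if_true, Pi.zero_apply]
  rw [sub_eq_zero]
  simp only [sum_mul]
  have hk : (order X : ℚ) - partSize X k =
      ∑ p, ((compSize (T p) : ℚ) - interSize k (T p)) := by
    rw [T.sum_comp fun p => (compSize p : ℚ) - interSize k p, sum_sub_distrib, sum_compSize,
      sum_interSize_eq_partSize]
  rw [sum_comm, hk]
  refine Finset.sum_congr rfl fun p _ => ?_
  have h0 := (alpha_pos hs (T p)).ne'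
  rw [eq_comm]
  calc _ = ((compSize (T p) : ℚ) - interSize k (T p)) / alpha (T p) *
        ∑ l, (interSize l (T p) : ℚ) * ((order X : ℚ) - partSize X l) := by
        rw [mul_sum]
        exact Finset.sum_congr rfl fun l _ => by ring
    _ = _ := by
        rw [← alpha_eq_sum_interSize]
        field_simp

lemma vecMul_Z [∀ i, Finite (X i)] [∀ i, Nonempty (X i)] (hs : 2 ≤ s) :
    (fun k => (partSize X k : ℚ)) ᵥ* Z T = 0 := by
  have := Fintype.ofFinite (Σ i, X i)
  ext l
  simp only [vecMul, dotProduct, Z_apply, mul_sub, sum_sub_distrib, one_apply, mul_ite, mul_one,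
    mul_zero, sum_ite_eq', mem_univ, if_true, Pi.zero_apply]
  rw [sub_eq_zero]
  simp only [mul_sum]
  rw [sum_comm, ← sum_interSize_eq_partSize (F := F) l, ← T.sum_comp]
  refine Finset.sum_congr rfl fun p _ => ?_
  have h0 := (alpha_pos hs (T p)).ne'
  rw [eq_comm]
  calc _ = (interSize l (T p) : ℚ) / alpha (T p) *
        ∑ k, (partSize X k : ℚ) * ((compSize (T p) : ℚ) - interSize k (T p)) := by
        rw [mul_sum]
        exact Finset.sum_congr rfl fun l _ => by ring
    _ = _ := by
        rw [← alpha_eq_sum_partSize]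
        field_simp

/-- The vector whose product with the all-ones column is added to `Z` to make it invertible. -/
noncomputable def shiftRow (F : SimpleGraph (Σ i, X i)) [Fintype F.ConnectedComponent]
    (l : Fin s) : ℚ :=
  ∑ p : F.ConnectedComponent, (compSize p : ℚ) * interSize l p / alpha p

lemma shiftRow_dotProduct [∀ i, Finite (X i)] [∀ i, Nonempty (X i)] [Fintype (Σ i, X i)]
    (hs : 2 ≤ s) :
    shiftRow F ⬝ᵥ (fun k => (order X : ℚ) - partSize X k) = order X := by
  rw [← sum_compSize (F := F)]
  simp only [dotProduct, shiftRow, sum_mul]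
  rw [sum_comm]
  refine Finset.sum_congr rfl fun p _ => ?_
  have h0 := (alpha_pos hs p).ne'
  rw [sum_compSize]
  calc _ = (compSize p : ℚ) / alpha p *
        ∑ l, (interSize l p : ℚ) * ((order X : ℚ) - partSize X l) := by
        rw [mul_sum]
        exact Finset.sum_congr rfl fun l _ => by ring
    _ = _ := by
        rw [← alpha_eq_sum_interSize]
        field_simp

lemma prod_alpha_mul_det_Z_add [∀ i, Finite (X i)] [∀ i, Nonempty (X i)] [Fintype (Σ i, X i)]
    (hs : 2 ≤ s) (hF : IsSpanningForest (K X) F) :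
    (∏ p, alpha (T p)) * (Z T + vecMulVec 1 (shiftRow F)).det =
      (order X : ℚ) * order X * tau (K X) F := by
  have : Nonempty (Σ i, X i) := ⟨⟨⟨0, by omega⟩, Classical.arbitrary _⟩⟩
  let N : Matrix (Fin s) F.ConnectedComponent ℚ := of fun k p => (interSize k p : ℚ)
  let Q : Matrix F.ConnectedComponent (Fin s) ℚ := of fun p l => (interSize l p : ℚ) / alpha p
  -- The shift cancels the m_p n_{lp} / α_p part of each entry.
  have hZ : Z T + vecMulVec 1 (shiftRow F) = 1 + N * Q := by
    ext k l
    rw [Matrix.add_apply, Matrix.add_apply, Z_apply, vecMulVec_apply, mul_apply, Pi.one_apply,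
      one_mul, T.sum_comp fun p => (interSize l p : ℚ) * ((compSize p : ℚ) - interSize k p) /
        alpha p, shiftRow, sub_add, ← sum_sub_distrib, sub_eq_add_neg, ← sum_neg_distrib]
    congr 1
    refine Finset.sum_congr rfl fun p _ => ?_
    simp only [N, Q, of_apply]
    ring
  have hD : diagonal (fun p : F.ConnectedComponent => alpha p) * (1 + Q * N) =
      (contractedLap (K X) F + vecMulVec (fun p => (compSize p : ℤ)) (fun p => (compSize p : ℤ))).map
        (fun z : ℤ => (z : ℚ)) := by
    ext p q
    have h0 := (alpha_pos hs p).ne'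
    rw [diagonal_mul, Matrix.add_apply, mul_apply, map_apply, Matrix.add_apply, vecMulVec_apply,
      Int.cast_add, contractedLap_multipartite_apply, mul_add, mul_sum, one_apply]
    have h1 : ∀ k, alpha p * (Q p k * N k q) = (interSize k p : ℚ) * interSize k q := by
      intro k
      simp only [N, Q, of_apply]
      field_simp
    rw [Finset.sum_congr rfl fun k _ => h1 k]
    push_cast
    split_ifs <;> ring
  rw [T.prod_comp (fun p => alpha p), hZ, det_one_add_mul_comm, ← det_diagonal, ← det_mul, hD,
    ← Int.cast_det, det_contractedLap_add_vecMulVec hF.2 hF.1]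
  push_cast
  rw [sum_compSize]

end Multipartite

end SpanForest

theorem theorem1 {s : ℕ} (hs : 2 ≤ s) (X : Fin s → Type*)
    [∀ i, Finite (X i)] [∀ i, Nonempty (X i)]
    (F : SimpleGraph (Σ i, X i)) (hF : SpanForest.IsSpanningForest (SpanForest.K X) F)
    (c : ℕ) (T : Fin c ≃ F.ConnectedComponent) (i j : Fin s) :
    (SpanForest.tau (SpanForest.K X) F : ℚ) =
      SpanForest.cofactor (SpanForest.Z T) i j /
          ((SpanForest.partSize X i : ℚ) *
            ((SpanForest.order X : ℚ) - SpanForest.partSize X j)) *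
        ∏ p, SpanForest.alpha (T p) := by
  classical
  have := Fintype.ofFinite (Σ i, X i)
  have hi : (SpanForest.partSize X i : ℚ) ≠ 0 := by
    exact_mod_cast (SpanForest.partSize_pos i).ne'
  have hj : (SpanForest.order X : ℚ) - SpanForest.partSize X j ≠ 0 :=
    sub_ne_zero.2 (by exact_mod_cast (SpanForest.partSize_lt_order hs j).ne')
  have hn : (SpanForest.order X : ℚ) ≠ 0 := by
    exact_mod_cast ((Nat.zero_le _).trans_lt (SpanForest.partSize_lt_order hs j)).ne'
  have h1 := Matrix.det_add_vecMulVec_mul (SpanForest.Z_mulVec T hs) (SpanForest.vecMul_Z T hs) 1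
    (SpanForest.shiftRow F) j i
  have h2 := SpanForest.prod_alpha_mul_det_Z_add T hs hF
  rw [SpanForest.shiftRow_dotProduct hs, dotProduct_one, ← SpanForest.order_eq_sum,
    ← SpanForest.cofactor_eq_adjugate] at h1
  field_simp
  -- In `h1`, n² is (w · x)(y · 1) for the kernel vectors x, y; in `h2` it is (∑ m_p)².
  refine mul_left_cancel₀ (mul_ne_zero hn hn) ?_
  linear_combination (∏ p, SpanForest.alpha (T p)) * h1 -
    (SpanForest.partSize X i : ℚ) * ((SpanForest.order X : ℚ) - SpanForest.partSize X j) * h2
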